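/- Let $A>0$, $\varepsilon>0$, and let $V:\mathbb R^3\to\mathbb C$ be continuously differentiable with $$|V(x)|\le A e^{-\varepsilon|x|},\qquad |\nabla V(x)|\le \varepsilon A e^{-\varepsilon|x|}\qquad(x\in\mathbb R^3),$$ where $|\nabla V(x)|$ is the norm of the differential of $V$ at $x$ as a real-linear map $\mathbb R^3\to\mathbb C$. Let $h_\varepsilon$ be the inverse of the bijection $g_\varepsilon:[0,\infty)\to[0,\infty)$, $g_\varepsilon(t)=te^{\varepsilon t}$. For $\lambda=k^2$ with $k\in\mathbb C$, $\operatorname{Im}k>0$, let $R_0(\lambda)$ be the free resolvent $(-\Delta-\lambda)^{-1}$, represented as the integral operator on $L^2(\mathbb R^3)$ with kernel $\frac{e^{ik|x-y|}}{4\pi|x-y|}$, and put $$G_\lambda(x,y)=\frac1{16\pi^2}\int_{\mathbb R^3}\frac{e^{ik|x-z|}e^{ik|z-y|}}{|x-z||z-y|}\,V(z)\,dz .$$ Then the integrals $\int_{\mathbb R^3}\frac{|V(y)|}{|x-y|}\,dy$ are finite and, as a function of $x$, attain their maximum; and for every $k$ with $\operatorname{Im}k>0$ the integral defining $G_\lambda(x,y)$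 converges absolutely for all $x,y\in\mathbb R^3$, $G_\lambda$ is the integral kernel of $R_0(\lambda)VR_0(\lambda)$ on $L^2(\mathbb R^3)$, and $$|G_\lambda(x,y)|\le\frac{\widetilde C}{h_\varepsilon(|k|)}\qquad (x,y\in\mathbb R^3),$$ where $$\widetilde C=\frac1{8\pi^2}\max\Big\{\max_{x\in\mathbb R^3}\int_{\mathbb R^3}\frac{|V(y)|}{|x-y|}\,dy,\ \pi A\,(1+\sqrt2\,\pi)\Big\}.$$ -/

import Mathlib

open MeasureTheory

noncomputable section

namespace Schrodinger

/-- The configuration space `ℝ³` with its Euclidean norm. -/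
abbrev E3 : Type := EuclideanSpace ℝ (Fin 3)

/-- The kernel `exp (i k |x - y|) / (4 π |x - y|)` of the free resolvent `(-Δ - k²)⁻¹`
(for `k` in the open upper half plane, so that `k = √(k²)` is the root with positive
imaginary part). -/
def freeKernel (k : ℂ) (x y : E3) : ℂ :=
  Complex.exp (Complex.I * k * ‖x - y‖) / (4 * Real.pi * ‖x - y‖)

/-- The free resolvent `R₀(k²)` as an integral operator. -/
def freeResolvent (k : ℂ) (f : E3 → ℂ) (x : E3) : ℂ :=
  ∫ y, freeKernel k x y * f y

/-- The operator `R₀(k²) V R₀(k²)`. -/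
def sandwich (V : E3 → ℂ) (k : ℂ) (f : E3 → ℂ) : E3 → ℂ :=
  freeResolvent k (fun z => V z * freeResolvent k f z)

/-- The integrand, as a function of `z`, of the integral that defines `G`. -/
def integrandG (V : E3 → ℂ) (k : ℂ) (x y z : E3) : ℂ :=
  Complex.exp (Complex.I * k * ‖x - z‖) * Complex.exp (Complex.I * k * ‖z - y‖) /
    (‖x - z‖ * ‖z - y‖) * V z

/-- `G_λ(x, y)`, `λ = k²`. -/
def G (V : E3 → ℂ) (k : ℂ) (x y : E3) : ℂ :=
  1 / (16 * Real.pi ^ 2) * ∫ z, integrandG V k x y z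

/-- `K` is the integral kernel of the operator `T` acting on square integrable functions. -/
def IsIntegralKernel (T : (E3 → ℂ) → E3 → ℂ) (K : E3 → E3 → ℂ) : Prop :=
  ∀ f : E3 → ℂ, MemLp f 2 volume → ∀ x : E3,
    Integrable (fun y => K x y * f y) volume ∧ T f x = ∫ y, K x y * f y

/-- The potential `x ↦ ∫ |V(y)| / |x - y| dy`. -/
def absPotential (V : E3 → ℂ) (x : E3) : ℝ :=
  ∫ y, ‖V y‖ / ‖x - y‖

/-- `g_ε(t) = t exp(ε t)`. -/
def g (ε t : ℝ) : ℝ := t * Real.exp (ε * t)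

/-- `h_ε`, the inverse of `g_ε : [0, ∞) → [0, ∞)`. -/
def h (ε : ℝ) : ℝ → ℝ := Function.invFunOn (g ε) (Set.Ici 0)

/-- The constant `C̃`. -/
def Ctilde (V : E3 → ℂ) (A : ℝ) : ℝ :=
  1 / (8 * Real.pi ^ 2) *
    max (⨆ x, absPotential V x) (Real.pi * A * (1 + Real.sqrt 2 * Real.pi))

/-- `g_ε` is a bijection of `[0, ∞)` onto itself, so that `h_ε` is its genuine inverse. -/
theorem g_bijOn {ε : ℝ} (hε : 0 < ε) : Set.BijOn (g ε) (Set.Ici 0) (Set.Ici 0) := by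
  refine ⟨fun t ht => mul_nonneg ht (Real.exp_pos _).le, ?_, ?_⟩
  · have hm : StrictMonoOn (g ε) (Set.Ici 0) := by
      intro a ha b hb hab
      have hb0 : 0 < b := lt_of_le_of_lt ha hab
      exact mul_lt_mul hab (Real.exp_le_exp.2 (by gcongr)) (Real.exp_pos _) hb0.le
    exact hm.injOn
  · intro s hs
    have hs0 : (0 : ℝ) ≤ s := hs
    have hc : ContinuousOn (g ε) (Set.Icc 0 s) := by
      unfold g
      fun_prop
    have h1 : s ≤ g ε s :=
      le_mul_of_one_le_right hs0 (Real.one_le_exp (mul_nonneg hε.le hs0))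
    have h2 : s ∈ Set.Icc (g ε 0) (g ε s) := ⟨by simpa [g] using hs0, h1⟩
    obtain ⟨t, ht, hts⟩ := intermediate_value_Icc hs0 hc h2
    exact ⟨t, ht.1, hts⟩

theorem h_invOn {ε : ℝ} (hε : 0 < ε) :
    Set.InvOn (h ε) (g ε) (Set.Ici 0) (Set.Ici 0) :=
  (g_bijOn hε).invOn_invFunOn

end Schrodinger

end

/-! The bound comes from prolate spheroidal coordinates with foci `x` and `y`. Let `2c` be the
distance between the foci, `c + s` half the sum of the distances from `z` to them, and `φ` the angle
about the axis. The two distances are then `c + s ± cτ`, and the volume element is their product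
times `dφ dτ ds` (`map_spheroidalPoint`). This cancels the denominator of the integrand of `G`, and
the exponentials combine to `exp(2ik(c + s))`, a function of `s` alone
(`focalProduct_smul_integrandG`).

One integration by parts in `s` then gains `1/|k|`. The boundary term is at most `A`. Along a
coordinate line both Cartesian components, axial and radial, are injective in `s` or constant, and
each bounds the norm of the position from below up to a shift. So each contributes at most `A ∫ ε
exp(-ε|v|) dv = 2A` to the integral of the derivative of `V`. A line gives at most `5A/(2|k|)`
(`norm_integral_spheroidal_line_le`), and integrating over `τ` (length 2) and `φ` (length `2π`)
gives `10πA/|k|`. The claim follows because `5 ≤ 1 + √2 π` and `h_ε(t) ≤ t`.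

The potential attains its maximum because it is continuous and `O(1/|x|)`. The kernel identity is
Fubini's theorem. -/

namespace Schrodinger

open Set Filter Topology

/-! ### Spheroidal coordinates in a half plane. -/

/-- Prolate spheroidal coordinates in a half plane, with foci at `(±c, 0)`. The coordinate `q.2`
is half the excess of the sum of the focal distances over the focal distance `2 * c`, so that
these are polar coordinates for `c = 0`. -/
noncomputable def spheroidal (c : ℝ) (q : ℝ × ℝ) : ℝ × ℝ :=
  ((c + q.2) * q.1, Real.sqrt (q.2 * (q.2 + 2 * c) * (1 - q.1 ^ 2)))

/-- The domain of `spheroidal`. -/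
def spheroidalDomain : Set (ℝ × ℝ) := Ioo (-1) 1 ×ˢ Ioi 0

theorem measurableSet_spheroidalDomain : MeasurableSet spheroidalDomain :=
  measurableSet_Ioo.prod measurableSet_Ioi

theorem spheroidal_radicand_pos {c : ℝ} (hc : 0 ≤ c) {q : ℝ × ℝ} (hq : q ∈ spheroidalDomain) :
    0 < q.2 * (q.2 + 2 * c) * (1 - q.1 ^ 2) := by
  obtain ⟨⟨h1, h2⟩, h3⟩ := hq
  have h3 : 0 < q.2 := h3
  have : 0 < 1 - q.1 ^ 2 := by nlinarith
  positivity

theorem spheroidal_snd_sq {c : ℝ} (hc : 0 ≤ c) {q : ℝ × ℝ} (hq : q ∈ spheroidalDomain) :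
    (spheroidal c q).2 ^ 2 = q.2 * (q.2 + 2 * c) * (1 - q.1 ^ 2) :=
  Real.sq_sqrt (spheroidal_radicand_pos hc hq).le

/-- The squared focal distances are perfect squares in these coordinates; this is what makes the
phase linear. -/
theorem spheroidal_focal_sq_add {c : ℝ} (hc : 0 ≤ c) {q : ℝ × ℝ} (hq : q ∈ spheroidalDomain) :
    ((spheroidal c q).1 + c) ^ 2 + (spheroidal c q).2 ^ 2 = (c + q.2 + c * q.1) ^ 2 := by
  rw [spheroidal_snd_sq hc hq]
  simp only [spheroidal]
  ring

theorem spheroidal_focal_sq_sub {c : ℝ} (hc : 0 ≤ c) {q : ℝ × ℝ} (hq : q ∈ spheroidalDomain) :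
    ((spheroidal c q).1 - c) ^ 2 + (spheroidal c q).2 ^ 2 = (c + q.2 - c * q.1) ^ 2 := by
  rw [spheroidal_snd_sq hc hq]
  simp only [spheroidal]
  ring

theorem focal_add_pos {c : ℝ} (hc : 0 ≤ c) {q : ℝ × ℝ} (hq : q ∈ spheroidalDomain) :
    0 < c + q.2 + c * q.1 := by
  obtain ⟨⟨h1, h2⟩, h3⟩ := hq
  have h3 : 0 < q.2 := h3
  nlinarith

theorem focal_sub_pos {c : ℝ} (hc : 0 ≤ c) {q : ℝ × ℝ} (hq : q ∈ spheroidalDomain) :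
    0 < c + q.2 - c * q.1 := by
  obtain ⟨⟨h1, h2⟩, h3⟩ := hq
  have h3 : 0 < q.2 := h3
  nlinarith

theorem spheroidal_injOn {c : ℝ} (hc : 0 ≤ c) : InjOn (spheroidal c) spheroidalDomain := by
  intro q hq q' hq' h
  have e1 := spheroidal_focal_sq_add hc hq
  rw [h, spheroidal_focal_sq_add hc hq'] at e1
  have e2 := spheroidal_focal_sq_sub hc hq
  rw [h, spheroidal_focal_sq_sub hc hq'] at e2
  have a1 := (sq_eq_sq₀ (focal_add_pos hc hq').le (focal_add_pos hc hq).le).1 e1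
  have a2 := (sq_eq_sq₀ (focal_sub_pos hc hq').le (focal_sub_pos hc hq).le).1 e2
  have hs : q.2 = q'.2 := by linarith
  have hu : (spheroidal c q).1 = (spheroidal c q').1 := by rw [h]
  simp only [spheroidal, hs] at hu
  have hp : 0 < q'.2 := hq'.2
  exact Prod.ext (mul_left_cancel₀ (by positivity) hu) hs

theorem spheroidal_image {c : ℝ} (hc : 0 ≤ c) :
    spheroidal c '' spheroidalDomain = univ ×ˢ Ioi 0 := by
  ext ⟨u, r⟩
  constructor
  · rintro ⟨q, hq, h⟩
    refine ⟨mem_univ _, ?_⟩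
    rw [← h]
    exact Real.sqrt_pos.2 (spheroidal_radicand_pos hc hq)
  · rintro ⟨-, hr⟩
    have hr : 0 < r := hr
    set a := Real.sqrt ((u + c) ^ 2 + r ^ 2) with ha
    set b := Real.sqrt ((u - c) ^ 2 + r ^ 2) with hb
    have ha2 : a ^ 2 = (u + c) ^ 2 + r ^ 2 := Real.sq_sqrt (by positivity)
    have hb2 : b ^ 2 = (u - c) ^ 2 + r ^ 2 := Real.sq_sqrt (by positivity)
    have ha' : |u + c| < a := by
      rw [← Real.sqrt_sq_eq_abs]
      exact Real.sqrt_lt_sqrt (sq_nonneg _) (by nlinarith)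
    have hb' : |u - c| < b := by
      rw [← Real.sqrt_sq_eq_abs]
      exact Real.sqrt_lt_sqrt (sq_nonneg _) (by nlinarith)
    rw [abs_lt] at ha' hb'
    -- Half the sum of the focal distances is the semi-major axis of the confocal ellipse through
    -- the point, so the preimage is `(u / S, S - c)`.
    set S := (a + b) / 2 with hS
    have hSc : c < S := by linarith
    have hSu : u < S := by linarith
    have hSu' : -S < u := by linarith
    have hS0 : 0 < S := by linarith
    refine ⟨(u / S, S - c), ⟨⟨?_, ?_⟩, ?_⟩, ?_⟩
    · change -1 < u / S
      rw [lt_div_iff₀ hS0]; linarith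
    · change u / S < 1
      rw [div_lt_iff₀ hS0]; linarith
    · change 0 < S - c
      linarith
    · simp only [spheroidal, Prod.mk.injEq]
      constructor
      · field_simp
        ring
      · rw [Real.sqrt_eq_iff_mul_self_eq_of_pos hr]
        -- The equation of that ellipse, obtained by eliminating `(a - b) / 2`.
        have key : (S ^ 2 - c ^ 2) * (S ^ 2 - u ^ 2) = S ^ 2 * r ^ 2 := by
          have h1 : S * ((a - b) / 2) = u * c := by rw [hS]; nlinarith
          have h2 : S ^ 2 + ((a - b) / 2) ^ 2 = u ^ 2 + c ^ 2 + r ^ 2 := by rw [hS]; nlinarith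
          have h3 : S ^ 2 * ((a - b) / 2) ^ 2 = u ^ 2 * c ^ 2 := by
            rw [← mul_pow, h1, mul_pow]
          linear_combination S ^ 2 * h2 - h3
        field_simp
        linear_combination -key

/-- The derivative of `spheroidal c`. -/
noncomputable def fderivSpheroidal (c : ℝ) (q : ℝ × ℝ) : ℝ × ℝ →L[ℝ] ℝ × ℝ :=
  (Matrix.toLin (.finTwoProd ℝ) (.finTwoProd ℝ)
    !![c + q.2, q.1;
      -(q.1 * (q.2 * (q.2 + 2 * c))) / (spheroidal c q).2,
      (q.2 + c) * (1 - q.1 ^ 2) / (spheroidal c q).2]).toContinuousLinearMap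

theorem hasFDerivAt_spheroidal {c : ℝ} (hc : 0 ≤ c) {q : ℝ × ℝ} (hq : q ∈ spheroidalDomain) :
    HasFDerivAt (spheroidal c) (fderivSpheroidal c q) q := by
  unfold fderivSpheroidal
  rw [Matrix.toLin_finTwoProd_toContinuousLinearMap]
  have hp := (spheroidal_radicand_pos hc hq).ne'
  have hfst : HasFDerivAt (𝕜 := ℝ) (fun q : ℝ × ℝ => q.1) _ q := hasFDerivAt_fst
  have hsnd : HasFDerivAt (𝕜 := ℝ) (fun q : ℝ × ℝ => q.2) _ q := hasFDerivAt_snd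
  have h1 := (hsnd.const_add c).mul hfst
  have h2 := ((hsnd.mul (hsnd.add_const (2 * c))).mul ((hfst.pow 2).const_sub 1)).sqrt hp
  refine (h1.prodMk h2).congr_fderiv ?_
  have hr : (spheroidal c q).2 ≠ 0 := (Real.sqrt_pos.2 (spheroidal_radicand_pos hc hq)).ne'
  have hr' : Real.sqrt (q.2 * (q.2 + 2 * c) * (1 - q.1 ^ 2)) = (spheroidal c q).2 := rfl
  refine ContinuousLinearMap.ext fun v => Prod.ext ?_ ?_
  · simp
  · simp [hr']
    field_simp
    ring

/-- The cylindrical weight removes the square root from the Jacobian and leaves the product of the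
focal distances. -/
theorem det_fderivSpheroidal {c : ℝ} (hc : 0 ≤ c) {q : ℝ × ℝ} (hq : q ∈ spheroidalDomain) :
    (fderivSpheroidal c q).det * (spheroidal c q).2 =
      (c + q.2 + c * q.1) * (c + q.2 - c * q.1) := by
  have hr : (spheroidal c q).2 ≠ 0 := (Real.sqrt_pos.2 (spheroidal_radicand_pos hc hq)).ne'
  unfold fderivSpheroidal
  rw [LinearMap.det_toContinuousLinearMap, LinearMap.det_toLin, Matrix.det_fin_two_of]
  field_simp
  ring

/-- The change of variables formula for spheroidal coordinates. The weight `p.2` is that of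
cylindrical coordinates. -/
theorem lintegral_spheroidal {c : ℝ} (hc : 0 ≤ c) (f : ℝ × ℝ → ENNReal) :
    ∫⁻ p in univ ×ˢ Ioi 0, ENNReal.ofReal p.2 * f p =
      ∫⁻ q in spheroidalDomain,
        ENNReal.ofReal ((c + q.2 + c * q.1) * (c + q.2 - c * q.1)) * f (spheroidal c q) := by
  rw [← spheroidal_image hc, lintegral_image_eq_lintegral_abs_det_fderiv_mul volume
    measurableSet_spheroidalDomain
    (fun q hq => (hasFDerivAt_spheroidal hc hq).hasFDerivWithinAt) (spheroidal_injOn hc)]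
  refine setLIntegral_congr_fun measurableSet_spheroidalDomain fun q hq => ?_
  have hr : 0 < (spheroidal c q).2 := Real.sqrt_pos.2 (spheroidal_radicand_pos hc hq)
  have hd := det_fderivSpheroidal hc hq
  have hpos := mul_pos (focal_add_pos hc hq) (focal_sub_pos hc hq)
  have hdet : 0 < (fderivSpheroidal c q).det := by
    rw [← hd] at hpos
    exact pos_of_mul_pos_left hpos hr.le
  rw [← mul_assoc, ← ENNReal.ofReal_mul (abs_nonneg _), abs_of_pos hdet, hd]

/-! ### Spheroidal coordinates in space. -/

/-- Cartesian coordinates centred at `m` with respect to the orthonormal basis `b`. -/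
noncomputable def cartesian (b : OrthonormalBasis (Fin 3) ℝ E3) (m : E3) (p : ℝ × (ℝ × ℝ)) : E3 :=
  m + (p.1 • b 0 + (p.2.1 • b 1 + p.2.2 • b 2))

theorem measurePreserving_cartesian (b : OrthonormalBasis (Fin 3) ℝ E3) (m : E3) :
    MeasurePreserving (cartesian b m) volume volume := by
  have h1 : MeasurePreserving (Prod.map id (MeasurableEquiv.finTwoArrow (α := ℝ)).symm)
      (volume : Measure (ℝ × (ℝ × ℝ))) volume :=
    (MeasurePreserving.id volume).prod ((volume_preserving_finTwoArrow ℝ).symm _)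
  have h2 := (volume_preserving_piFinSuccAbove (fun _ : Fin 3 => ℝ) 0).symm
  have h3 := (EuclideanSpace.volume_preserving_symm_measurableEquiv_toLp (Fin 3)).symm
  have h4 := b.measurePreserving_repr_symm
  have h5 := measurePreserving_add_left (volume : Measure E3) m
  have h := h5.comp (h4.comp (h3.comp (h2.comp h1)))
  convert h using 1
  funext p
  simp [cartesian, ← b.sum_repr_symm, Fin.sum_univ_three, MeasurableEquiv.piFinSuccAbove,
    add_assoc]

theorem continuous_cartesian (b : OrthonormalBasis (Fin 3) ℝ E3) (m : E3) :
    Continuous (cartesian b m) := by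
  unfold cartesian
  fun_prop

/-- Integration in cylindrical coordinates, the angle being integrated last. -/
theorem lintegral_cylindrical (b : OrthonormalBasis (Fin 3) ℝ E3) (m : E3) {F : E3 → ENNReal}
    (hF : Measurable F) :
    ∫⁻ z, F z = ∫⁻ φ in Ioo (-Real.pi) Real.pi, ∫⁻ p in univ ×ˢ Ioi (0 : ℝ),
      ENNReal.ofReal p.2 *
        F (cartesian b m (p.1, (p.2 * Real.cos φ, p.2 * Real.sin φ))) := by
  have hC := (continuous_cartesian b m).measurable
  have hm : Measurable fun t : ℝ × (ℝ × ℝ) => ENNReal.ofReal t.2.1 *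
      F (cartesian b m (t.1, (t.2.1 * Real.cos t.2.2, t.2.1 * Real.sin t.2.2))) := by
    fun_prop
  have hFC : Measurable fun p => F (cartesian b m p) := hF.comp hC
  rw [← (measurePreserving_cartesian b m).lintegral_comp hF, Measure.volume_eq_prod,
    lintegral_prod _ hFC.aemeasurable]
  have h1 : ∀ u : ℝ, ∫⁻ w : ℝ × ℝ, F (cartesian b m (u, w)) =
      ∫⁻ φ in Ioo (-Real.pi) Real.pi, ∫⁻ r in Ioi (0 : ℝ), ENNReal.ofReal r *
        F (cartesian b m (u, (r * Real.cos φ, r * Real.sin φ))) := by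
    intro u
    rw [← lintegral_comp_polarCoord_symm, polarCoord_target, Measure.volume_eq_prod,
      ← Measure.prod_restrict, lintegral_prod_symm]
    · rfl
    · exact (hm.comp (measurable_prodMk_left (x := u))).aemeasurable
  simp_rw [h1]
  rw [lintegral_lintegral_swap]
  · refine lintegral_congr fun φ => ?_
    rw [Measure.volume_eq_prod, ← Measure.prod_restrict, lintegral_prod, Measure.restrict_univ]
    exact (hm.comp (f := fun p : ℝ × ℝ => (p.1, (p.2, φ))) (by fun_prop)).aemeasurable
  · refine Measurable.aemeasurable ?_
    refine Measurable.lintegral_prod_right' (f := fun t : (ℝ × ℝ) × ℝ => ENNReal.ofReal t.2 *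
      F (cartesian b m (t.1.1, (t.2 * Real.cos t.1.2, t.2 * Real.sin t.1.2)))) ?_
    exact hm.comp (f := fun t : (ℝ × ℝ) × ℝ => (t.1.1, (t.2, t.1.2))) (by fun_prop)

/-- The measure `dφ dτ ds` on the domain of the spheroidal coordinates of `ℝ³`. -/
noncomputable def spheroidalMeasure : Measure (ℝ × (ℝ × ℝ)) :=
  (volume.restrict (Ioo (-Real.pi) Real.pi)).prod (volume.restrict spheroidalDomain)

/-- Prolate spheroidal coordinates in `ℝ³`, with foci at `m ± c • b 0`. -/
noncomputable def spheroidalPoint (b : OrthonormalBasis (Fin 3) ℝ E3) (m : E3) (c : ℝ)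
    (p : ℝ × (ℝ × ℝ)) : E3 :=
  cartesian b m ((spheroidal c p.2).1,
    ((spheroidal c p.2).2 * Real.cos p.1, (spheroidal c p.2).2 * Real.sin p.1))

theorem continuous_spheroidal (c : ℝ) : Continuous (spheroidal c) := by
  unfold spheroidal
  fun_prop

theorem continuous_spheroidalPoint (b : OrthonormalBasis (Fin 3) ℝ E3) (m : E3) (c : ℝ) :
    Continuous (spheroidalPoint b m c) := by
  have := continuous_cartesian b m
  have := continuous_spheroidal c
  unfold spheroidalPoint
  fun_prop

/-- The product of the distances to the two foci. -/
def focalProduct (c : ℝ) (p : ℝ × (ℝ × ℝ)) : ℝ :=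
  (c + p.2.2 + c * p.2.1) * (c + p.2.2 - c * p.2.1)

theorem continuous_focalProduct (c : ℝ) : Continuous (focalProduct c) := by
  unfold focalProduct
  fun_prop

/-- Lebesgue measure in spheroidal coordinates. -/
theorem map_spheroidalPoint (b : OrthonormalBasis (Fin 3) ℝ E3) (m : E3) {c : ℝ} (hc : 0 ≤ c) :
    (spheroidalMeasure.withDensity fun p => ENNReal.ofReal (focalProduct c p)).map
      (spheroidalPoint b m c) = volume := by
  have hZ := (continuous_spheroidalPoint b m c).measurable
  have hd : Measurable fun p => ENNReal.ofReal (focalProduct c p) :=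
    (continuous_focalProduct c).measurable.ennreal_ofReal
  refine Measure.ext_of_lintegral _ fun F hF => ?_
  have hFZ : Measurable fun p => F (spheroidalPoint b m c p) := hF.comp hZ
  rw [lintegral_map hF hZ, lintegral_withDensity_eq_lintegral_mul _ hd hFZ,
    lintegral_cylindrical b m hF, spheroidalMeasure,
    lintegral_prod _ (hd.mul hFZ).aemeasurable]
  refine lintegral_congr fun φ => ?_
  rw [lintegral_spheroidal hc
    (fun p => F (cartesian b m (p.1, (p.2 * Real.cos φ, p.2 * Real.sin φ))))]
  rfl

theorem ae_mem_spheroidalDomain : ∀ᵐ p ∂spheroidalMeasure, p.2 ∈ spheroidalDomain :=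
  Measure.quasiMeasurePreserving_snd.ae (ae_restrict_mem measurableSet_spheroidalDomain)

/-- The change of variables formula for spheroidal coordinates in `ℝ³`. -/
theorem integral_eq_integral_spheroidal (b : OrthonormalBasis (Fin 3) ℝ E3) (m : E3) {c : ℝ}
    (hc : 0 ≤ c) {F : E3 → ℂ} (hF : Integrable F) :
    Integrable (fun p => focalProduct c p • F (spheroidalPoint b m c p)) spheroidalMeasure ∧
    ∫ z, F z = ∫ p, focalProduct c p • F (spheroidalPoint b m c p) ∂spheroidalMeasure := by
  have hZ := (continuous_spheroidalPoint b m c).measurable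
  have hd : Measurable fun p => (focalProduct c p).toNNReal :=
    (continuous_focalProduct c).measurable.real_toNNReal
  have hmap := map_spheroidalPoint b m hc
  have hae : (fun p => (focalProduct c p).toNNReal • F (spheroidalPoint b m c p))
      =ᵐ[spheroidalMeasure] fun p => focalProduct c p • F (spheroidalPoint b m c p) := by
    filter_upwards [ae_mem_spheroidalDomain] with p hp
    have : 0 ≤ focalProduct c p := (mul_pos (focal_add_pos hc hp) (focal_sub_pos hc hp)).le
    rw [NNReal.smul_def, Real.coe_toNNReal _ this]
  have hF' := hF
  rw [← hmap] at hF'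
  constructor
  · have h1 := hF'.comp_measurable hZ
    refine Integrable.congr ?_ hae
    exact (integrable_withDensity_iff_integrable_smul hd).1 h1
  · rw [← integral_congr_ae hae]
    have h2 : ∫ z, F z = ∫ z, F z ∂((spheroidalMeasure.withDensity
        fun p => ENNReal.ofReal (focalProduct c p)).map (spheroidalPoint b m c)) := by rw [hmap]
    rw [h2, integral_map hZ.aemeasurable hF'.aestronglyMeasurable]
    exact integral_withDensity_eq_integral_smul hd _

/-! ### The oscillatory integral along a coordinate line. -/

theorem integrable_exp_neg_mul_abs {ε : ℝ} (hε : 0 < ε) :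
    Integrable fun v : ℝ => ε * Real.exp (-ε * |v|) := by
  have h := (integrable_fun_norm_addHaar (volume : Measure ℝ) (F := ℝ)
    (f := fun y => Real.exp (-ε * y))).2
    (by simpa using integrableOn_exp_mul_Ioi (neg_lt_zero.2 hε) 0)
  exact h.const_mul ε

theorem lintegral_exp_neg_mul_abs {ε : ℝ} (hε : 0 < ε) (q : ℝ) :
    ∫⁻ v : ℝ, ENNReal.ofReal (ε * Real.exp (-ε * |q + v|)) = ENNReal.ofReal 2 := by
  rw [lintegral_add_left_eq_self (fun v => ENNReal.ofReal (ε * Real.exp (-ε * |v|))) q,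
    ← ofReal_integral_eq_lintegral_ofReal (integrable_exp_neg_mul_abs hε)
      (ae_of_all _ fun v => by positivity),
    integral_comp_abs (f := fun v => ε * Real.exp (-ε * v)), integral_const_mul,
    integral_exp_mul_Ioi (neg_lt_zero.2 hε)]
  congr 1
  simp
  field_simp

/-- An injective path in `ℝ` has weighted length at most the total mass of the weight. -/
theorem lintegral_deriv_mul_exp_neg_le {ε : ℝ} (hε : 0 < ε) (q : ℝ) {r r' : ℝ → ℝ}
    (hr : ∀ s ∈ Ioi (0 : ℝ), HasDerivAt r (r' s) s) (hinj : InjOn r (Ioi 0)) :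
    ∫⁻ s in Ioi (0 : ℝ), ENNReal.ofReal (|r' s| * (ε * Real.exp (-ε * |q + r s|))) ≤
      ENNReal.ofReal 2 := by
  rw [← lintegral_exp_neg_mul_abs hε q]
  simp_rw [ENNReal.ofReal_mul (abs_nonneg _)]
  rw [← lintegral_image_eq_lintegral_abs_deriv_mul measurableSet_Ioi
    (fun s hs => (hr s hs).hasDerivWithinAt) hinj
    (fun v => ENNReal.ofReal (ε * Real.exp (-ε * |q + v|)))]
  exact setLIntegral_le_lintegral _ _

theorem lintegral_linear_mul_exp_neg_le {ε : ℝ} (hε : 0 < ε) (q c τ : ℝ) :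
    ∫⁻ s in Ioi (0 : ℝ), ENNReal.ofReal (|τ| * (ε * Real.exp (-ε * |q + (c + s) * τ|))) ≤
      ENNReal.ofReal 2 := by
  -- For `τ = 0` the path is constant, hence not injective, but its speed vanishes.
  rcases eq_or_ne τ 0 with rfl | hτ
  · simp
  · refine lintegral_deriv_mul_exp_neg_le hε q (r := fun s => (c + s) * τ) (r' := fun _ => τ)
      (fun s _ => ?_) fun s _ t _ hst => ?_
    · simpa using ((hasDerivAt_id s).const_add c).mul_const τ
    · exact add_left_cancel (mul_right_cancel₀ hτ hst)

section Path

variable {c τ : ℝ}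

theorem hasDerivAt_spheroidal_snd (hc : 0 ≤ c) (hτ : τ ∈ Ioo (-1 : ℝ) 1) {s : ℝ} (hs : 0 < s) :
    HasDerivAt (fun s => (spheroidal c (τ, s)).2)
      ((s + c) * (1 - τ ^ 2) / (spheroidal c (τ, s)).2) s := by
  have hp := (spheroidal_radicand_pos hc (q := (τ, s)) ⟨hτ, hs⟩)
  have hr : (spheroidal c (τ, s)).2 ≠ 0 := (Real.sqrt_pos.2 hp).ne'
  have h := ((((hasDerivAt_id s).mul ((hasDerivAt_id s).add_const (2 * c))).mul_const
    (1 - τ ^ 2))).sqrt hp.ne'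
  refine h.congr_deriv ?_
  have hr' : Real.sqrt (s * (s + 2 * c) * (1 - τ ^ 2)) = (spheroidal c (τ, s)).2 := rfl
  simp [hr']
  field_simp
  ring

theorem spheroidal_snd_injOn (hc : 0 ≤ c) (hτ : τ ∈ Ioo (-1 : ℝ) 1) :
    InjOn (fun s => (spheroidal c (τ, s)).2) (Ioi 0) := by
  intro s hs t ht hst
  have hs' : 0 < s := hs
  have ht' : 0 < t := ht
  have h1 := spheroidal_snd_sq hc (q := (τ, s)) ⟨hτ, hs⟩
  have h2 := spheroidal_snd_sq hc (q := (τ, t)) ⟨hτ, ht⟩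
  simp only at hst
  rw [hst, h2] at h1
  have hτ' : 0 < 1 - τ ^ 2 := by nlinarith [hτ.1, hτ.2]
  have h3 : t * (t + 2 * c) = s * (s + 2 * c) := mul_right_cancel₀ hτ'.ne' h1
  have h4 : (t - s) * (t + s + 2 * c) = 0 := by linear_combination h3
  rcases mul_eq_zero.1 h4 with h | h
  · linarith
  · linarith

end Path

/-- The oscillatory integral along a spheroidal coordinate line (half a branch of a hyperbola). -/
theorem norm_integral_spheroidal_line_le {V : E3 → ℂ} {A ε : ℝ} (hA : 0 < A) (hε : 0 < ε)
    (hV : ContDiff ℝ 1 V) (hVdecay : ∀ x, ‖V x‖ ≤ A * Real.exp (-ε * ‖x‖))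
    (hVgrad : ∀ x, ‖fderiv ℝ V x‖ ≤ ε * A * Real.exp (-ε * ‖x‖))
    {e n : E3} (he : ‖e‖ = 1) (hn : ‖n‖ = 1) (hen : inner ℝ e n = 0) (m : E3)
    {c τ : ℝ} (hc : 0 ≤ c) (hτ : τ ∈ Ioo (-1 : ℝ) 1) {k : ℂ} (hk : 0 < k.im) :
    ‖∫ s in Ioi (0 : ℝ), Complex.exp (2 * Complex.I * k * ((c + s : ℝ) : ℂ)) *
      V (m + ((spheroidal c (τ, s)).1 • e + (spheroidal c (τ, s)).2 • n))‖ ≤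
      5 * A / (2 * ‖k‖) := by
  set r : ℝ → ℝ := fun s => (spheroidal c (τ, s)).2 with hrdef
  set r' : ℝ → ℝ := fun s => (s + c) * (1 - τ ^ 2) / r s with hr'def
  set Z : ℝ → E3 := fun s => m + (((c + s) * τ) • e + r s • n) with hZdef
  set W : ℝ → ℂ := fun s => fderiv ℝ V (Z s) (τ • e + r' s • n) with hWdef
  set E : ℝ → ℂ := fun s => Complex.exp (2 * Complex.I * k * ((c + s : ℝ) : ℂ)) with hEdef
  change ‖∫ s in Ioi (0 : ℝ), E s * V (Z s)‖ ≤ _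
  have hrcont : Continuous r := (continuous_spheroidal c).snd.comp (by fun_prop)
  have hrpos : ∀ s ∈ Ioi (0 : ℝ), 0 < r s := fun s hs =>
    Real.sqrt_pos.2 (spheroidal_radicand_pos hc (q := (τ, s)) ⟨hτ, hs⟩)
  have hrder : ∀ s ∈ Ioi (0 : ℝ), HasDerivAt r (r' s) s := fun s hs =>
    hasDerivAt_spheroidal_snd hc hτ hs
  have hZcont : Continuous Z := by fun_prop
  have hZder : ∀ s ∈ Ioi (0 : ℝ), HasDerivAt Z (τ • e + r' s • n) s := by
    intro s hs
    have h1 : HasDerivAt (fun s => (c + s) * τ) τ s := by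
      simpa using ((hasDerivAt_id s).const_add c).mul_const τ
    exact ((h1.smul_const e).add ((hrder s hs).smul_const n)).const_add m
  have hEcont : Continuous E := by fun_prop
  have hEnorm : ∀ s, ‖E s‖ = Real.exp (-(2 * k.im) * (c + s)) := by
    intro s
    rw [hEdef, Complex.norm_exp]
    congr 1
    simp
  have hEle : ∀ s ∈ Ioi (0 : ℝ), ‖E s‖ ≤ Real.exp (-(2 * k.im) * s) := by
    intro s hs
    rw [hEnorm]
    refine Real.exp_le_exp.2 ?_
    nlinarith [mul_nonneg hk.le hc]
  have hEone : ∀ s, 0 ≤ s → ‖E s‖ ≤ 1 := by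
    intro s hs
    rw [hEnorm]
    refine Real.exp_le_one_iff.2 ?_
    nlinarith [mul_nonneg hk.le hc, mul_nonneg hk.le hs]
  have hVA : ∀ x, ‖V x‖ ≤ A := fun x => (hVdecay x).trans
    (mul_le_of_le_one_right hA.le (Real.exp_le_one_iff.2 (by nlinarith [norm_nonneg x])))
  have hee : inner ℝ e e = 1 := by rw [real_inner_self_eq_norm_sq, he]; norm_num
  have hnn : inner ℝ n n = 1 := by rw [real_inner_self_eq_norm_sq, hn]; norm_num
  have hne : inner ℝ n e = 0 := by rw [real_inner_comm, hen]
  have hZe : ∀ s, |inner ℝ e m + (c + s) * τ| ≤ ‖Z s‖ := by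
    intro s
    have h := abs_real_inner_le_norm e (Z s)
    simpa [hZdef, inner_add_right, real_inner_smul_right, hee, hen, he] using h
  have hZn : ∀ s, |inner ℝ n m + r s| ≤ ‖Z s‖ := by
    intro s
    have h := abs_real_inner_le_norm n (Z s)
    simpa [hZdef, inner_add_right, real_inner_smul_right, hnn, hne, hn] using h
  -- The velocity is split into axial and radial parts, and each is paired with the decay in its own
  -- component, so that each term is a one-dimensional weighted length.
  have hWle : ∀ s, ‖W s‖ ≤
      A * (|τ| * (ε * Real.exp (-ε * |inner ℝ e m + (c + s) * τ|)) +
        |r' s| * (ε * Real.exp (-ε * |inner ℝ n m + r s|))) := by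
    intro s
    have h1 : ‖τ • e + r' s • n‖ ≤ |τ| + |r' s| := by
      refine (norm_add_le _ _).trans_eq ?_
      rw [norm_smul, norm_smul, he, hn, Real.norm_eq_abs, Real.norm_eq_abs, mul_one, mul_one]
    have h2 : Real.exp (-ε * ‖Z s‖) ≤ Real.exp (-ε * |inner ℝ e m + (c + s) * τ|) :=
      Real.exp_le_exp.2 (by nlinarith [hZe s])
    have h3 : Real.exp (-ε * ‖Z s‖) ≤ Real.exp (-ε * |inner ℝ n m + r s|) :=
      Real.exp_le_exp.2 (by nlinarith [hZn s])
    calc ‖W s‖ ≤ ‖fderiv ℝ V (Z s)‖ * ‖τ • e + r' s • n‖ := ContinuousLinearMap.le_opNorm _ _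
      _ ≤ (ε * A * Real.exp (-ε * ‖Z s‖)) * (|τ| + |r' s|) := by
          gcongr
          exact hVgrad _
      _ = A * (|τ| * (ε * Real.exp (-ε * ‖Z s‖)) + |r' s| * (ε * Real.exp (-ε * ‖Z s‖))) := by
          ring
      _ ≤ _ := by gcongr
  have hWlint : ∫⁻ s in Ioi (0 : ℝ), ‖W s‖ₑ ≤ ENNReal.ofReal (4 * A) := by
    calc ∫⁻ s in Ioi (0 : ℝ), ‖W s‖ₑ ≤ ∫⁻ s in Ioi (0 : ℝ), ENNReal.ofReal A *
          (ENNReal.ofReal (|τ| * (ε * Real.exp (-ε * |inner ℝ e m + (c + s) * τ|))) +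
            ENNReal.ofReal (|r' s| * (ε * Real.exp (-ε * |inner ℝ n m + r s|)))) := by
          refine lintegral_mono fun s => ?_
          rw [← ENNReal.ofReal_add (by positivity) (by positivity), ← ENNReal.ofReal_mul hA.le,
            ← ofReal_norm]
          exact ENNReal.ofReal_le_ofReal (hWle s)
      _ ≤ ENNReal.ofReal A * (ENNReal.ofReal 2 + ENNReal.ofReal 2) := by
          rw [lintegral_const_mul' _ _ ENNReal.ofReal_ne_top, lintegral_add_left (by fun_prop)]
          gcongr
          · exact lintegral_linear_mul_exp_neg_le hε _ c τ
          · exact lintegral_deriv_mul_exp_neg_le hε _ hrder (spheroidal_snd_injOn hc hτ)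
      _ = ENNReal.ofReal (4 * A) := by
          rw [← ENNReal.ofReal_add (by norm_num) (by norm_num), ← ENNReal.ofReal_mul hA.le]
          congr 1
          ring
  have hr'cont : ContinuousOn r' (Ioi 0) :=
    ContinuousOn.div (by fun_prop) hrcont.continuousOn fun s hs => (hrpos s hs).ne'
  have hWcont : ContinuousOn W (Ioi 0) := by
    have h1 : Continuous fun s => fderiv ℝ V (Z s) :=
      (hV.continuous_fderiv (by norm_num)).comp hZcont
    exact h1.continuousOn.clm_apply
      (continuousOn_const.add (hr'cont.smul continuousOn_const))
  have hWint : IntegrableOn W (Ioi 0) :=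
    ⟨hWcont.aestronglyMeasurable measurableSet_Ioi, hWlint.trans_lt ENNReal.ofReal_lt_top⟩
  have hEWint : IntegrableOn (fun s => E s * W s) (Ioi 0) := by
    refine Integrable.bdd_mul hWint hEcont.aestronglyMeasurable (c := 1) ?_
    filter_upwards [ae_restrict_mem measurableSet_Ioi] with s hs
    exact hEone s (le_of_lt hs)
  have hVZcont : Continuous fun s => V (Z s) := hV.continuous.comp hZcont
  have hfle : ∀ s ∈ Ioi (0 : ℝ), ‖E s * V (Z s)‖ ≤ Real.exp (-(2 * k.im) * s) * A := by
    intro s hs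
    rw [norm_mul]
    exact mul_le_mul (hEle s hs) (hVA _) (norm_nonneg _) (Real.exp_pos _).le
  have hfint : IntegrableOn (fun s => E s * V (Z s)) (Ioi 0) := by
    refine Integrable.mono' ((integrableOn_exp_mul_Ioi (a := -(2 * k.im)) (by linarith) 0).mul_const
      A) (hEcont.mul hVZcont).aestronglyMeasurable ?_
    filter_upwards [ae_restrict_mem measurableSet_Ioi] with s hs using hfle s hs
  have hlim : Tendsto (fun s => E s * V (Z s)) atTop (𝓝 0) := by
    refine squeeze_zero_norm' (a := fun s => Real.exp (-(2 * k.im) * s) * A) ?_ ?_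
    · filter_upwards [eventually_gt_atTop 0] with s hs using hfle s hs
    · have h1 : Tendsto (fun s : ℝ => -(2 * k.im) * s) atTop atBot :=
        tendsto_id.const_mul_atTop_of_neg (by linarith)
      simpa using (Real.tendsto_exp_atBot.comp h1).mul_const A
  have hEder : ∀ s, HasDerivAt E (2 * Complex.I * k * E s) s := by
    intro s
    have h1 : HasDerivAt (fun s : ℝ => ((c + s : ℝ) : ℂ)) 1 s := by
      simpa using ((hasDerivAt_id s).const_add c).ofReal_comp
    refine ((h1.const_mul (2 * Complex.I * k)).cexp).congr_deriv ?_
    simp only [hEdef]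
    ring
  have hfder : ∀ s ∈ Ioi (0 : ℝ), HasDerivAt (fun s => E s * V (Z s))
      (2 * Complex.I * k * (E s * V (Z s)) + E s * W s) s := by
    intro s hs
    have h1 : HasDerivAt (fun s => V (Z s)) (W s) s :=
      ((hV.differentiable (by norm_num) (Z s)).hasFDerivAt).comp_hasDerivAt s (hZder s hs)
    refine ((hEder s).mul h1).congr_deriv ?_
    ring
  -- For `c > 0` the speed `r'` blows up as `s → 0`; only continuity at the endpoint and
  -- integrability of the derivative are needed.
  have hparts := integral_Ioi_of_hasDerivAt_of_tendsto
    (hEcont.mul hVZcont).continuousWithinAt hfder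
    ((hfint.const_mul (2 * Complex.I * k)).add hEWint) hlim
  rw [integral_add (hfint.const_mul _) hEWint, integral_const_mul] at hparts
  have hk0 : 0 < ‖k‖ := norm_pos_iff.2 fun h => by simp [h] at hk
  have hI : 2 * Complex.I * k * ∫ s in Ioi (0 : ℝ), E s * V (Z s) =
      -(E 0 * V (Z 0)) - ∫ s in Ioi (0 : ℝ), E s * W s := by
    rw [← sub_eq_zero] at hparts ⊢
    rw [← hparts]
    simp only [Pi.mul_apply]
    ring
  have hEW : ‖∫ s in Ioi (0 : ℝ), E s * W s‖ ≤ 4 * A := by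
    refine (ENNReal.ofReal_le_ofReal_iff (by positivity)).1 ?_
    rw [ofReal_norm]
    refine (enorm_integral_le_lintegral_enorm _).trans (le_trans ?_ hWlint)
    refine lintegral_mono_ae ?_
    filter_upwards [ae_restrict_mem measurableSet_Ioi] with s hs
    rw [← ofReal_norm, ← ofReal_norm, norm_mul]
    exact ENNReal.ofReal_le_ofReal
      (mul_le_of_le_one_left (norm_nonneg _) (hEone s (le_of_lt hs)))
  have h0 : ‖E 0 * V (Z 0)‖ ≤ A := by
    rw [norm_mul]
    exact (mul_le_of_le_one_left (norm_nonneg _) (hEone 0 le_rfl)).trans (hVA _)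
  have hnorm := congrArg norm hI
  rw [norm_mul, norm_mul, norm_mul, Complex.norm_I, Complex.norm_two] at hnorm
  have := norm_sub_le (-(E 0 * V (Z 0))) (∫ s in Ioi (0 : ℝ), E s * W s)
  rw [norm_neg, ← hnorm] at this
  rw [le_div_iff₀ (by positivity)]
  linarith

/-! ### Integrability, and the maximum of the potential. -/

theorem integrable_exp_neg_mul_norm_div_pow {δ : ℝ} (hδ : 0 < δ) {j : ℕ} (hj : j ≤ 2) :
    Integrable fun w : E3 => Real.exp (-δ * ‖w‖) / ‖w‖ ^ j := by
  refine (integrable_fun_norm_addHaar (volume : Measure E3) (F := ℝ)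
    (f := fun y => Real.exp (-δ * y) / y ^ j)).2 ?_
  have h := integrableOn_rpow_mul_exp_neg_mul_rpow (p := 1) (s := ((2 - j : ℕ) : ℝ)) (b := δ)
    (by have : (0 : ℝ) ≤ ((2 - j : ℕ) : ℝ) := Nat.cast_nonneg _
        linarith) one_pos hδ
  refine h.congr_fun (fun y hy => ?_) measurableSet_Ioi
  have hy : 0 < y := hy
  simp only [finrank_euclideanSpace_fin, Real.rpow_natCast, Real.rpow_one, smul_eq_mul]
  rw [pow_sub₀ _ hy.ne' hj]
  ring

theorem integrable_exp_neg_mul_norm {δ : ℝ} (hδ : 0 < δ) :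
    Integrable fun w : E3 => Real.exp (-δ * ‖w‖) := by
  simpa using integrable_exp_neg_mul_norm_div_pow hδ (j := 0) (by norm_num)

section Decay

variable {V : E3 → ℂ} {A ε : ℝ}

theorem norm_sub_le_exp_mul (hA : 0 < A) (hε : 0 < ε)
    (hVdecay : ∀ x, ‖V x‖ ≤ A * Real.exp (-ε * ‖x‖)) {x : E3} {R : ℝ} (hx : ‖x‖ ≤ R) (w : E3) :
    ‖V (x - w)‖ ≤ A * Real.exp (ε * R) * Real.exp (-ε * ‖w‖) := by
  refine (hVdecay _).trans ?_
  rw [mul_assoc, ← Real.exp_add]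
  refine mul_le_mul_of_nonneg_left (Real.exp_le_exp.2 ?_) hA.le
  have h : ‖w‖ ≤ ‖x - w‖ + ‖x‖ := by
    simpa [norm_sub_rev] using norm_sub_le (x - w) x
  nlinarith

theorem integrable_norm_div_pow (hA : 0 < A) (hε : 0 < ε) (hV : Continuous V)
    (hVdecay : ∀ x, ‖V x‖ ≤ A * Real.exp (-ε * ‖x‖)) {j : ℕ} (hj : j ≤ 2) (x : E3) :
    Integrable fun z => ‖V z‖ / ‖x - z‖ ^ j := by
  have h := ((integrable_exp_neg_mul_norm_div_pow hε hj).const_mul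
    (A * Real.exp (ε * ‖x‖))).comp_sub_left x
  have hm : Measurable fun z => ‖V z‖ / ‖x - z‖ ^ j := by fun_prop
  refine h.mono' hm.aestronglyMeasurable (ae_of_all _ fun z => ?_)
  have h1 := norm_sub_le_exp_mul hA hε hVdecay le_rfl (x - z) (x := x)
  rw [sub_sub_cancel] at h1
  rw [Real.norm_of_nonneg (by positivity), ← mul_div_assoc]
  gcongr

theorem integrable_norm_div (hA : 0 < A) (hε : 0 < ε) (hV : Continuous V)
    (hVdecay : ∀ x, ‖V x‖ ≤ A * Real.exp (-ε * ‖x‖)) (x : E3) :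
    Integrable fun z => ‖V z‖ / ‖x - z‖ := by
  simpa using integrable_norm_div_pow hA hε hV hVdecay (j := 1) (by norm_num) x

theorem absPotential_nonneg (V : E3 → ℂ) (x : E3) : 0 ≤ absPotential V x :=
  integral_nonneg fun _ => by positivity

theorem continuous_absPotential (hA : 0 < A) (hε : 0 < ε) (hV : Continuous V)
    (hVdecay : ∀ x, ‖V x‖ ≤ A * Real.exp (-ε * ‖x‖)) : Continuous (absPotential V) := by
  -- Translation fixes the singularity at the origin, so that one dominating function serves all `x`
  -- near `x₀`.
  have hsub : absPotential V = fun x => ∫ w, ‖V (x - w)‖ / ‖w‖ := by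
    funext x
    rw [absPotential, ← integral_sub_left_eq_self (fun w => ‖V (x - w)‖ / ‖w‖) volume x]
    simp
  rw [hsub, continuous_iff_continuousAt]
  intro x₀
  refine continuousAt_of_dominated
    (bound := fun w => A * Real.exp (ε * (‖x₀‖ + 1)) * (Real.exp (-ε * ‖w‖) / ‖w‖)) ?_ ?_ ?_ ?_
  · refine Eventually.of_forall fun x => Measurable.aestronglyMeasurable ?_
    fun_prop
  · filter_upwards [Metric.ball_mem_nhds x₀ one_pos] with x hx
    refine ae_of_all _ fun w => ?_
    have hx' : ‖x‖ ≤ ‖x₀‖ + 1 := by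
      have h := norm_le_norm_add_norm_sub x₀ x
      rw [Metric.mem_ball, dist_eq_norm, norm_sub_rev] at hx
      linarith
    rw [Real.norm_of_nonneg (by positivity), ← mul_div_assoc]
    gcongr
    exact norm_sub_le_exp_mul hA hε hVdecay hx' w
  · simpa using (integrable_exp_neg_mul_norm_div_pow hε (j := 1) (by norm_num)).const_mul
      (A * Real.exp (ε * (‖x₀‖ + 1)))
  · exact ae_of_all _ fun w => by fun_prop

/-- Use `‖x‖ ≤ ‖x - y‖ + ‖y‖`: the first term cancels the denominator, and the second is absorbed by
half of the exponential decay of `V`. -/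
theorem exists_norm_mul_absPotential_le (hA : 0 < A) (hε : 0 < ε) (hV : Continuous V)
    (hVdecay : ∀ x, ‖V x‖ ≤ A * Real.exp (-ε * ‖x‖)) :
    ∃ C, ∀ x, ‖x‖ * absPotential V x ≤ C := by
  have i1 := integrable_exp_neg_mul_norm hε
  have i2 : Integrable fun w : E3 => Real.exp (-1 * ‖w‖) / ‖w‖ := by
    simpa using integrable_exp_neg_mul_norm_div_pow one_pos (j := 1) (by norm_num)
  have i3 := integrable_exp_neg_mul_norm (half_pos hε)
  refine ⟨A * ((∫ y : E3, Real.exp (-ε * ‖y‖)) + 2 / ε *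
    (Real.exp 1 * (∫ w : E3, Real.exp (-1 * ‖w‖) / ‖w‖) +
      ∫ y : E3, Real.exp (-(ε / 2) * ‖y‖))), fun x => ?_⟩
  have i2' := i2.comp_sub_left x
  have i4 : Integrable fun y : E3 => Real.exp 1 * (Real.exp (-1 * ‖x - y‖) / ‖x - y‖) :=
    i2'.const_mul _
  have i5 : Integrable fun y : E3 => 2 / ε *
      (Real.exp 1 * (Real.exp (-1 * ‖x - y‖) / ‖x - y‖) + Real.exp (-(ε / 2) * ‖y‖)) :=
    (i4.add i3).const_mul _
  have hI : A * ((∫ y : E3, Real.exp (-ε * ‖y‖)) + 2 / ε *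
      (Real.exp 1 * (∫ w : E3, Real.exp (-1 * ‖w‖) / ‖w‖) +
        ∫ y : E3, Real.exp (-(ε / 2) * ‖y‖))) =
      ∫ y : E3, A * (Real.exp (-ε * ‖y‖) + 2 / ε *
        (Real.exp 1 * (Real.exp (-1 * ‖x - y‖) / ‖x - y‖) + Real.exp (-(ε / 2) * ‖y‖))) := by
    rw [integral_const_mul, integral_add i1 i5,
      integral_const_mul, integral_add i4 i3, integral_const_mul,
      integral_sub_left_eq_self (fun w : E3 => Real.exp (-1 * ‖w‖) / ‖w‖) volume x]
  rw [hI, absPotential, ← integral_const_mul]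
  refine integral_mono ((integrable_norm_div hA hε hV hVdecay x).const_mul _)
    ((i1.add i5).const_mul _) fun y => ?_
  rcases eq_or_ne x y with rfl | hxy
  · simp only [sub_self, norm_zero, div_zero, mul_zero]
    positivity
  have ha : 0 < ‖x - y‖ := norm_pos_iff.2 (sub_ne_zero.2 hxy)
  have h1 : ‖x‖ ≤ ‖x - y‖ + ‖y‖ := by simpa using norm_add_le (x - y) y
  have h2 : ‖y‖ * Real.exp (-ε * ‖y‖) ≤ 2 / ε * Real.exp (-(ε / 2) * ‖y‖) := by
    have h3 : ε / 2 * ‖y‖ ≤ Real.exp (ε / 2 * ‖y‖) := by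
      linarith [Real.add_one_le_exp (ε / 2 * ‖y‖)]
    have h4 : Real.exp (-ε * ‖y‖) = Real.exp (-(ε / 2) * ‖y‖) * Real.exp (-(ε / 2) * ‖y‖) := by
      rw [← Real.exp_add]
      ring_nf
    have h5 : Real.exp (ε / 2 * ‖y‖) * Real.exp (-(ε / 2) * ‖y‖) = 1 := by
      rw [← Real.exp_add]
      simp
    have h6 : ‖y‖ = 2 / ε * (ε / 2 * ‖y‖) := by field_simp
    calc ‖y‖ * Real.exp (-ε * ‖y‖)
        = 2 / ε * ((ε / 2 * ‖y‖) * Real.exp (-(ε / 2) * ‖y‖) * Real.exp (-(ε / 2) * ‖y‖)) := by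
          rw [h4]
          field_simp
      _ ≤ 2 / ε * (Real.exp (ε / 2 * ‖y‖) * Real.exp (-(ε / 2) * ‖y‖) *
          Real.exp (-(ε / 2) * ‖y‖)) := by gcongr
      _ = 2 / ε * Real.exp (-(ε / 2) * ‖y‖) := by rw [h5, one_mul]
  -- Split at distance 1: nearby, `exp(1 - ‖x - y‖) ≥ 1` supplies an integrable bound; farther away
  -- the denominator can be dropped.
  have h7 : Real.exp (-(ε / 2) * ‖y‖) / ‖x - y‖ ≤
      Real.exp 1 * (Real.exp (-1 * ‖x - y‖) / ‖x - y‖) + Real.exp (-(ε / 2) * ‖y‖) := by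
    have hle1 : Real.exp (-(ε / 2) * ‖y‖) ≤ 1 :=
      Real.exp_le_one_iff.2 (by nlinarith [norm_nonneg y])
    rcases le_total ‖x - y‖ 1 with h | h
    · have h8 : 1 ≤ Real.exp 1 * Real.exp (-1 * ‖x - y‖) := by
        rw [← Real.exp_add]
        exact Real.one_le_exp (by linarith)
      have h9 : Real.exp (-(ε / 2) * ‖y‖) / ‖x - y‖ ≤
          Real.exp 1 * Real.exp (-1 * ‖x - y‖) / ‖x - y‖ := by
        gcongr
        linarith
      rw [← mul_div_assoc]
      exact h9.trans (le_add_of_nonneg_right (Real.exp_pos _).le)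
    · have h9 := div_le_self (Real.exp_pos (-(ε / 2) * ‖y‖)).le h
      exact h9.trans (le_add_of_nonneg_left (by positivity))
  calc ‖x‖ * (‖V y‖ / ‖x - y‖)
      ≤ (‖x - y‖ + ‖y‖) * (A * Real.exp (-ε * ‖y‖) / ‖x - y‖) := by
        gcongr
        exact hVdecay y
    _ = A * (Real.exp (-ε * ‖y‖) + ‖y‖ * Real.exp (-ε * ‖y‖) / ‖x - y‖) := by
        field_simp
    _ ≤ A * (Real.exp (-ε * ‖y‖) + 2 / ε * Real.exp (-(ε / 2) * ‖y‖) / ‖x - y‖) := by gcongr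
    _ ≤ _ := by
        rw [mul_div_assoc (2 / ε)]
        gcongr

theorem exists_absPotential_max (hA : 0 < A) (hε : 0 < ε) (hV : Continuous V)
    (hVdecay : ∀ x, ‖V x‖ ≤ A * Real.exp (-ε * ‖x‖)) :
    ∃ x₀, ∀ x, absPotential V x ≤ absPotential V x₀ := by
  -- A vanishing potential is maximal everywhere; a positive value exceeds all values outside some
  -- compact set.
  by_cases h0 : ∀ x, absPotential V x ≤ 0
  · exact ⟨0, fun x => (h0 x).trans (absPotential_nonneg V 0)⟩
  push Not at h0
  obtain ⟨x₁, hx₁⟩ := h0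
  obtain ⟨C, hC⟩ := exists_norm_mul_absPotential_le hA hε hV hVdecay
  refine (continuous_absPotential hA hε hV hVdecay).exists_forall_ge' x₁ ?_
  filter_upwards [(tendsto_norm_cocompact_atTop (E := E3)).eventually_gt_atTop
    (max 0 (C / absPotential V x₁))] with x hx
  have hx0 : 0 < ‖x‖ := (le_max_left _ _).trans_lt hx
  have hx1 : C / absPotential V x₁ < ‖x‖ := (le_max_right _ _).trans_lt hx
  rw [div_lt_iff₀ hx₁] at hx1
  exact le_of_mul_le_mul_left ((hC x).trans hx1.le) hx0

theorem isGreatest_iSup_absPotential (hA : 0 < A) (hε : 0 < ε) (hV : Continuous V)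
    (hVdecay : ∀ x, ‖V x‖ ≤ A * Real.exp (-ε * ‖x‖)) :
    IsGreatest (range (absPotential V)) (⨆ x, absPotential V x) := by
  obtain ⟨x₀, h⟩ := exists_absPotential_max hA hε hV hVdecay
  have hg : IsGreatest (range (absPotential V)) (absPotential V x₀) :=
    ⟨mem_range_self _, forall_mem_range.2 h⟩
  rwa [← hg.csSup_eq] at hg

theorem norm_cexp_I_mul_le_one {k : ℂ} (hk : 0 < k.im) {t : ℝ} (ht : 0 ≤ t) :
    ‖Complex.exp (Complex.I * k * t)‖ ≤ 1 := by
  rw [Complex.norm_exp, Real.exp_le_one_iff]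
  simpa using mul_nonneg hk.le ht

theorem measurable_integrandG (hV : Continuous V) (k : ℂ) (x y : E3) :
    Measurable (integrandG V k x y) := by
  unfold integrandG
  fun_prop

theorem integrable_integrandG (hA : 0 < A) (hε : 0 < ε) (hV : Continuous V)
    (hVdecay : ∀ x, ‖V x‖ ≤ A * Real.exp (-ε * ‖x‖)) {k : ℂ} (hk : 0 < k.im) (x y : E3) :
    Integrable (integrandG V k x y) := by
  have h := ((integrable_norm_div_pow hA hε hV hVdecay le_rfl x).add
    (integrable_norm_div_pow hA hε hV hVdecay le_rfl y))
  refine h.mono' (measurable_integrandG hV k x y).aestronglyMeasurable (ae_of_all _ fun z => ?_)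
  have h1 := norm_cexp_I_mul_le_one hk (norm_nonneg (x - z))
  have h2 := norm_cexp_I_mul_le_one hk (norm_nonneg (z - y))
  -- Separating the two singularities leaves inverse squares, integrable in dimension 3 even when `x
  -- = y`.
  have h3 : ‖x - z‖⁻¹ * ‖z - y‖⁻¹ ≤ (‖x - z‖ ^ 2)⁻¹ + (‖z - y‖ ^ 2)⁻¹ := by
    rw [← inv_pow, ← inv_pow]
    nlinarith [sq_nonneg (‖x - z‖⁻¹ - ‖z - y‖⁻¹), sq_nonneg ‖x - z‖⁻¹, sq_nonneg ‖z - y‖⁻¹]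
  rw [integrandG, norm_mul, norm_div, norm_mul, norm_mul, Complex.norm_real, Complex.norm_real,
    norm_norm, norm_norm, div_eq_mul_inv, mul_inv]
  calc _ ≤ 1 * 1 * (‖x - z‖⁻¹ * ‖z - y‖⁻¹) * ‖V z‖ := by gcongr
    _ ≤ ((‖x - z‖ ^ 2)⁻¹ + (‖z - y‖ ^ 2)⁻¹) * ‖V z‖ := by
        rw [one_mul, one_mul]
        gcongr
    _ = _ := by
        rw [Pi.add_apply, norm_sub_rev y z]
        ring

end Decay

/-! ### The uniform bound on `G`. -/

/-- Supplies an axis direction also for coinciding foci, where the coordinates are polar. -/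
theorem exists_unit_smul_eq (w : E3) : ∃ v : E3, ‖v‖ = 1 ∧ ‖w‖ • v = w := by
  rcases eq_or_ne w 0 with rfl | hw
  · obtain ⟨v, hv⟩ := exists_norm_eq E3 zero_le_one
    exact ⟨v, hv, by simp⟩
  · refine ⟨‖w‖⁻¹ • w, norm_smul_inv_norm hw, ?_⟩
    rw [smul_smul, mul_inv_cancel₀ (norm_ne_zero_iff.2 hw), one_smul]

theorem exists_orthonormalBasis_zero_eq {v : E3} (hv : ‖v‖ = 1) :
    ∃ b : OrthonormalBasis (Fin 3) ℝ E3, b 0 = v := by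
  have ho : Orthonormal ℝ (({0} : Set (Fin 3)).domRestrict fun _ => v) :=
    ⟨fun _ => hv, fun i j hij => absurd (Subsingleton.elim i j) hij⟩
  obtain ⟨b, hb⟩ := ho.exists_orthonormalBasis_extension_of_card_eq (by simp)
  exact ⟨b, hb 0 rfl⟩

/-- The unit vector orthogonal to `b 0` at angle `φ`. -/
noncomputable def radialVector (b : OrthonormalBasis (Fin 3) ℝ E3) (φ : ℝ) : E3 :=
  Real.cos φ • b 1 + Real.sin φ • b 2

theorem inner_radialVector (b : OrthonormalBasis (Fin 3) ℝ E3) (φ : ℝ) :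
    inner ℝ (b 0) (radialVector b φ) = 0 := by
  simp [radialVector, inner_add_right, real_inner_smul_right, b.inner_eq_ite]

theorem norm_radialVector (b : OrthonormalBasis (Fin 3) ℝ E3) (φ : ℝ) :
    ‖radialVector b φ‖ = 1 := by
  have h : ‖radialVector b φ‖ ^ 2 = 1 := by
    rw [radialVector, norm_add_sq_real]
    simp [norm_smul, real_inner_smul_right, real_inner_smul_left, b.inner_eq_ite]
  exact (pow_eq_one_iff_of_nonneg (norm_nonneg _) two_ne_zero).1 h

theorem spheroidalPoint_eq (b : OrthonormalBasis (Fin 3) ℝ E3) (m : E3) (c φ : ℝ) (q : ℝ × ℝ) :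
    spheroidalPoint b m c (φ, q) =
      m + ((spheroidal c q).1 • b 0 + (spheroidal c q).2 • radialVector b φ) := by
  simp [spheroidalPoint, cartesian, radialVector, smul_smul]

theorem norm_smul_add_smul_radialVector (b : OrthonormalBasis (Fin 3) ℝ E3) (φ u r : ℝ) :
    ‖u • b 0 + r • radialVector b φ‖ ^ 2 = u ^ 2 + r ^ 2 := by
  rw [norm_add_sq_real, real_inner_smul_left, real_inner_smul_right, inner_radialVector,
    norm_smul, norm_smul, norm_radialVector, b.norm_eq_one]
  simp

theorem norm_sub_spheroidalPoint (b : OrthonormalBasis (Fin 3) ℝ E3) (m : E3) {c : ℝ}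
    (hc : 0 ≤ c) {p : ℝ × (ℝ × ℝ)} (hp : p.2 ∈ spheroidalDomain) :
    ‖m - c • b 0 - spheroidalPoint b m c p‖ = c + p.2.2 + c * p.2.1 := by
  obtain ⟨φ, q⟩ := p
  refine (sq_eq_sq₀ (norm_nonneg _) (focal_add_pos hc hp).le).1 ?_
  have h : m - c • b 0 - spheroidalPoint b m c (φ, q) =
      -(((spheroidal c q).1 + c) • b 0 + (spheroidal c q).2 • radialVector b φ) := by
    rw [spheroidalPoint_eq]
    module
  rw [h, norm_neg, norm_smul_add_smul_radialVector, spheroidal_focal_sq_add hc hp]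

theorem norm_spheroidalPoint_sub (b : OrthonormalBasis (Fin 3) ℝ E3) (m : E3) {c : ℝ}
    (hc : 0 ≤ c) {p : ℝ × (ℝ × ℝ)} (hp : p.2 ∈ spheroidalDomain) :
    ‖spheroidalPoint b m c p - (m + c • b 0)‖ = c + p.2.2 - c * p.2.1 := by
  obtain ⟨φ, q⟩ := p
  refine (sq_eq_sq₀ (norm_nonneg _) (focal_sub_pos hc hp).le).1 ?_
  have h : spheroidalPoint b m c (φ, q) - (m + c • b 0) =
      ((spheroidal c q).1 - c) • b 0 + (spheroidal c q).2 • radialVector b φ := by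
    rw [spheroidalPoint_eq]
    module
  rw [h, norm_smul_add_smul_radialVector, spheroidal_focal_sq_sub hc hp]

theorem focalProduct_smul_integrandG (V : E3 → ℂ) (k : ℂ) (b : OrthonormalBasis (Fin 3) ℝ E3)
    (m : E3) {c : ℝ} (hc : 0 ≤ c) {p : ℝ × (ℝ × ℝ)} (hp : p.2 ∈ spheroidalDomain) :
    focalProduct c p • integrandG V k (m - c • b 0) (m + c • b 0) (spheroidalPoint b m c p) =
      Complex.exp (2 * Complex.I * k * ((c + p.2.2 : ℝ) : ℂ)) * V (spheroidalPoint b m c p) := by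
  rw [integrandG, norm_sub_spheroidalPoint b m hc hp, norm_spheroidalPoint_sub b m hc hp,
    ← Complex.exp_add, focalProduct]
  have h1 : ((c + p.2.2 + c * p.2.1 : ℝ) : ℂ) ≠ 0 :=
    Complex.ofReal_ne_zero.2 (focal_add_pos hc hp).ne'
  have h2 : ((c + p.2.2 - c * p.2.1 : ℝ) : ℂ) ≠ 0 :=
    Complex.ofReal_ne_zero.2 (focal_sub_pos hc hp).ne'
  have h3 : Complex.I * k * ((c + p.2.2 + c * p.2.1 : ℝ) : ℂ) +
      Complex.I * k * ((c + p.2.2 - c * p.2.1 : ℝ) : ℂ) =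
      2 * Complex.I * k * ((c + p.2.2 : ℝ) : ℂ) := by
    push_cast
    ring
  rw [h3, Complex.real_smul, Complex.ofReal_mul]
  field_simp

section Bound

variable {V : E3 → ℂ} {A ε : ℝ}

theorem norm_integral_integrandG_le (hA : 0 < A) (hε : 0 < ε) (hV : ContDiff ℝ 1 V)
    (hVdecay : ∀ x, ‖V x‖ ≤ A * Real.exp (-ε * ‖x‖))
    (hVgrad : ∀ x, ‖fderiv ℝ V x‖ ≤ ε * A * Real.exp (-ε * ‖x‖)) {k : ℂ} (hk : 0 < k.im)
    (x y : E3) : ‖∫ z, integrandG V k x y z‖ ≤ 10 * Real.pi * A / ‖k‖ := by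
  obtain ⟨v, hv, hvxy⟩ := exists_unit_smul_eq (y - x)
  obtain ⟨b, hb⟩ := exists_orthonormalBasis_zero_eq hv
  -- Here `m` is the midpoint of the foci and `c` half their distance.
  obtain ⟨c, m, hc, hx, hy⟩ : ∃ (c : ℝ) (m : E3), 0 ≤ c ∧ x = m - c • b 0 ∧ y = m + c • b 0 := by
    refine ⟨‖y - x‖ / 2, x + (‖y - x‖ / 2) • b 0, by positivity, by simp, ?_⟩
    rw [add_assoc, ← add_smul, add_halves, hb, hvxy]
    abel
  have hint := integrable_integrandG hA hε hV.continuous hVdecay hk x y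
  rw [hx, hy] at hint ⊢
  obtain ⟨hi, heq⟩ := integral_eq_integral_spheroidal b m hc hint
  have hae : (fun p => focalProduct c p •
      integrandG V k (m - c • b 0) (m + c • b 0) (spheroidalPoint b m c p)) =ᵐ[spheroidalMeasure]
      fun p => Complex.exp (2 * Complex.I * k * ((c + p.2.2 : ℝ) : ℂ)) *
        V (spheroidalPoint b m c p) := by
    filter_upwards [ae_mem_spheroidalDomain] with p hp
    exact focalProduct_smul_integrandG V k b m hc hp
  have hi' := hi.congr hae
  rw [heq, integral_congr_ae hae]
  rw [spheroidalMeasure] at hi' ⊢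
  rw [integral_prod _ hi']
  have hinner : ∀ᵐ φ ∂volume.restrict (Ioo (-Real.pi) Real.pi),
      ‖∫ q in spheroidalDomain, Complex.exp (2 * Complex.I * k * ((c + q.2 : ℝ) : ℂ)) *
        V (spheroidalPoint b m c (φ, q))‖ ≤ 5 * A / (2 * ‖k‖) * 2 := by
    filter_upwards [hi'.prod_right_ae] with φ hφ
    rw [spheroidalDomain, Measure.volume_eq_prod, ← Measure.prod_restrict] at hφ ⊢
    rw [integral_prod _ hφ]
    refine (norm_integral_le_of_norm_le_const (C := 5 * A / (2 * ‖k‖)) ?_).trans_eq ?_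
    · filter_upwards [ae_restrict_mem measurableSet_Ioo] with τ hτ
      simp_rw [spheroidalPoint_eq]
      exact norm_integral_spheroidal_line_le hA hε hV hVdecay hVgrad (b.norm_eq_one 0)
        (norm_radialVector b φ) (inner_radialVector b φ) m hc hτ hk
    · simp [Measure.real]
      norm_num
  refine (norm_integral_le_of_norm_le_const hinner).trans_eq ?_
  have hk0 : ‖k‖ ≠ 0 := (norm_pos_iff.2 fun h => by simp [h] at hk).ne'
  have hvol : (volume.restrict (Ioo (-Real.pi) Real.pi)).real univ = 2 * Real.pi := by
    rw [Measure.real, Measure.restrict_apply_univ, Real.volume_Ioo,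
      ENNReal.toReal_ofReal (by linarith [Real.pi_pos])]
    ring
  rw [hvol]
  field_simp
  ring

theorem norm_G_le (hA : 0 < A) (hε : 0 < ε) (hV : ContDiff ℝ 1 V)
    (hVdecay : ∀ x, ‖V x‖ ≤ A * Real.exp (-ε * ‖x‖))
    (hVgrad : ∀ x, ‖fderiv ℝ V x‖ ≤ ε * A * Real.exp (-ε * ‖x‖)) {k : ℂ} (hk : 0 < k.im)
    (x y : E3) : ‖G V k x y‖ ≤ 1 / (8 * Real.pi ^ 2) * (Real.pi * A * 5) / ‖k‖ := by
  have h := norm_integral_integrandG_le hA hε hV hVdecay hVgrad hk x y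
  have hc : ‖(1 / (16 * (Real.pi : ℂ) ^ 2))‖ = 1 / (16 * Real.pi ^ 2) := by
    simp [abs_of_pos Real.pi_pos]
  rw [G, norm_mul, hc]
  calc _ ≤ 1 / (16 * Real.pi ^ 2) * (10 * Real.pi * A / ‖k‖) := by gcongr
    _ = _ := by ring

theorem h_pos {t : ℝ} (hε : 0 < ε) (ht : 0 < t) : 0 < h ε t := by
  have h0 : 0 ≤ h ε t := (g_bijOn hε).surjOn.mapsTo_invFunOn ht.le
  have h1 : g ε (h ε t) = t := (h_invOn hε).2 ht.le
  refine h0.lt_of_ne fun h2 => ?_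
  rw [← h2] at h1
  simp [g] at h1
  linarith

/-- Since `g_ε(t) ≥ t`, decay in `1/|k|` is stronger than decay in `1/h_ε(|k|)`. -/
theorem h_le_self {t : ℝ} (hε : 0 < ε) (ht : 0 < t) : h ε t ≤ t := by
  have h0 := h_pos hε ht
  have h1 : h ε t * Real.exp (ε * h ε t) = t := (h_invOn hε).2 ht.le
  calc h ε t ≤ h ε t * Real.exp (ε * h ε t) :=
        le_mul_of_one_le_right h0.le (Real.one_le_exp (by positivity))
    _ = t := h1

theorem five_le_one_add_sqrt_two_mul_pi : 5 ≤ 1 + Real.sqrt 2 * Real.pi := by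
  have h1 : 1.4 ≤ Real.sqrt 2 := Real.le_sqrt_of_sq_le (by norm_num)
  nlinarith [Real.pi_gt_d2]

theorem norm_G_le_Ctilde_div (hA : 0 < A) (hε : 0 < ε) (hV : ContDiff ℝ 1 V)
    (hVdecay : ∀ x, ‖V x‖ ≤ A * Real.exp (-ε * ‖x‖))
    (hVgrad : ∀ x, ‖fderiv ℝ V x‖ ≤ ε * A * Real.exp (-ε * ‖x‖)) {k : ℂ} (hk : 0 < k.im)
    (x y : E3) : ‖G V k x y‖ ≤ Ctilde V A / h ε ‖k‖ := by
  have hk0 : 0 < ‖k‖ := norm_pos_iff.2 fun h => by simp [h] at hk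
  refine (norm_G_le hA hε hV hVdecay hVgrad hk x y).trans ?_
  -- The second entry of the maximum already suffices.
  have hC : 1 / (8 * Real.pi ^ 2) * (Real.pi * A * 5) ≤ Ctilde V A := by
    refine mul_le_mul_of_nonneg_left (le_max_of_le_right ?_) (by positivity)
    have := five_le_one_add_sqrt_two_mul_pi
    gcongr
  have hpos : 0 ≤ 1 / (8 * Real.pi ^ 2) * (Real.pi * A * 5) := by positivity
  exact div_le_div₀ (hpos.trans hC) hC (h_pos hε hk0) (h_le_self hε hk0)

end Bound

/-! ### The integral kernel of the sandwiched resolvent. -/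

theorem measurable_freeKernel (k : ℂ) : Measurable fun p : E3 × E3 => freeKernel k p.1 p.2 := by
  unfold freeKernel
  fun_prop

theorem norm_freeKernel (k : ℂ) (x y : E3) :
    ‖freeKernel k x y‖ = Real.exp (-k.im * ‖x - y‖) / (4 * Real.pi * ‖x - y‖) := by
  rw [freeKernel, norm_div, Complex.norm_exp]
  simp [abs_of_pos Real.pi_pos]

theorem norm_freeKernel_le {k : ℂ} (hk : 0 < k.im) (x y : E3) :
    ‖freeKernel k x y‖ ≤ 1 / ‖x - y‖ := by
  rw [norm_freeKernel]
  have h1 : Real.exp (-k.im * ‖x - y‖) ≤ 1 :=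
    Real.exp_le_one_iff.2 (by nlinarith [norm_nonneg (x - y)])
  have h2 : (1 : ℝ) ≤ 4 * Real.pi := by linarith [Real.pi_gt_three]
  rw [← div_div]
  gcongr
  exact (div_le_one (by positivity)).2 (h1.trans h2)

theorem norm_freeKernel_sq (k : ℂ) (x y : E3) :
    ‖freeKernel k x y‖ ^ 2 =
      1 / (16 * Real.pi ^ 2) * (Real.exp (-(2 * k.im) * ‖y - x‖) / ‖y - x‖ ^ 2) := by
  have h : Real.exp (-(2 * k.im) * ‖x - y‖) = Real.exp (-k.im * ‖x - y‖) ^ 2 := by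
    rw [← Real.exp_nat_mul]
    congr 1
    push_cast
    ring
  rw [norm_freeKernel, norm_sub_rev y x, h, div_pow]
  ring

theorem G_eq_integral_freeKernel (V : E3 → ℂ) (k : ℂ) (x y : E3) :
    G V k x y = ∫ z, freeKernel k x z * V z * freeKernel k z y := by
  rw [G, ← integral_const_mul]
  congr 1
  funext z
  simp only [integrandG, freeKernel, div_eq_mul_inv, mul_inv]
  ring

section Kernel

variable {V : E3 → ℂ} {A ε : ℝ}

theorem integrable_freeKernel_mul (hA : 0 < A) (hε : 0 < ε) (hV : Continuous V)
    (hVdecay : ∀ x, ‖V x‖ ≤ A * Real.exp (-ε * ‖x‖)) {k : ℂ} (hk : 0 < k.im) (x : E3) :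
    Integrable fun z => freeKernel k x z * V z := by
  refine (integrable_norm_div hA hε hV hVdecay x).mono'
    (((measurable_freeKernel k).comp (measurable_prodMk_left (x := x))).mul
      hV.measurable).aestronglyMeasurable (ae_of_all _ fun z => ?_)
  rw [norm_mul]
  calc _ ≤ 1 / ‖x - z‖ * ‖V z‖ := by
        gcongr
        exact norm_freeKernel_le hk x z
    _ = _ := by ring

/-- A Fubini criterion for a kernel dominated by a square integrable convolution kernel. -/
theorem integrable_mul_kernel_mul {u f : E3 → ℂ} {K : E3 → E3 → ℂ} {w : E3 → ℝ}
    (hu : Integrable u) (hf : MemLp f 2 volume) (hw : Integrable w)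
    (hK : Measurable fun p : E3 × E3 => K p.1 p.2) (hKw : ∀ z y, ‖K z y‖ ^ 2 = w (y - z)) :
    Integrable (fun p : E3 × E3 => u p.2 * K p.2 p.1 * f p.1) (volume.prod volume) := by
  have hf2 : Integrable fun y => ‖f y‖ ^ 2 := hf.integrable_norm_pow two_ne_zero
  have h1 : Integrable (fun p : E3 × E3 => ‖f p.1‖ ^ 2 * ‖u p.2‖) (volume.prod volume) :=
    hf2.mul_prod hu.norm
  have h2 : Integrable (fun p : E3 × E3 => ‖u p.2‖ * w (p.1 - p.2)) (volume.prod volume) :=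
    hu.norm.convolution_integrand (ContinuousLinearMap.mul ℝ ℝ) hw
  have hK' : Measurable fun p : E3 × E3 => K p.2 p.1 := hK.comp measurable_swap
  refine (h1.add h2).mono' ((hu.aestronglyMeasurable.comp_snd.mul
    hK'.aestronglyMeasurable).mul hf.aestronglyMeasurable.comp_fst) (ae_of_all _ fun p => ?_)
  rw [Pi.add_apply, ← hKw, norm_mul, norm_mul]
  -- This splits the integrand into a product of integrable functions and a convolution integrand.
  have h3 : ‖K p.2 p.1‖ * ‖f p.1‖ ≤ ‖f p.1‖ ^ 2 + ‖K p.2 p.1‖ ^ 2 := by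
    nlinarith [sq_nonneg (‖K p.2 p.1‖ - ‖f p.1‖), sq_nonneg ‖f p.1‖, sq_nonneg ‖K p.2 p.1‖]
  calc _ = ‖u p.2‖ * (‖K p.2 p.1‖ * ‖f p.1‖) := by ring
    _ ≤ ‖u p.2‖ * (‖f p.1‖ ^ 2 + ‖K p.2 p.1‖ ^ 2) := by gcongr
    _ = _ := by ring

theorem integrable_freeKernel_mul_mul (hA : 0 < A) (hε : 0 < ε) (hV : Continuous V)
    (hVdecay : ∀ x, ‖V x‖ ≤ A * Real.exp (-ε * ‖x‖)) {k : ℂ} (hk : 0 < k.im)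
    {f : E3 → ℂ} (hf : MemLp f 2 volume) (x : E3) :
    Integrable (fun p : E3 × E3 => freeKernel k x p.2 * V p.2 * freeKernel k p.2 p.1 * f p.1)
      (volume.prod volume) :=
  integrable_mul_kernel_mul (u := fun z => freeKernel k x z * V z) (K := freeKernel k)
    (w := fun w => 1 / (16 * Real.pi ^ 2) * (Real.exp (-(2 * k.im) * ‖w‖) / ‖w‖ ^ 2))
    (integrable_freeKernel_mul hA hε hV hVdecay hk x) hf
    ((integrable_exp_neg_mul_norm_div_pow (by linarith) le_rfl).const_mul _)
    (measurable_freeKernel k) (norm_freeKernel_sq k)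

/-- Fubini applies at every `x`, not just almost every one, because `z ↦ freeKernel k x z * V z` is
always integrable. -/
theorem isIntegralKernel_G (hA : 0 < A) (hε : 0 < ε) (hV : Continuous V)
    (hVdecay : ∀ x, ‖V x‖ ≤ A * Real.exp (-ε * ‖x‖)) {k : ℂ} (hk : 0 < k.im) :
    IsIntegralKernel (sandwich V k) (G V k) := by
  intro f hf x
  have h := integrable_freeKernel_mul_mul hA hε hV hVdecay hk hf x
  have hG : ∀ y, G V k x y * f y =
      ∫ z, freeKernel k x z * V z * freeKernel k z y * f y := fun y => by
    rw [G_eq_integral_freeKernel, integral_mul_const]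
  simp_rw [hG]
  refine ⟨h.integral_prod_left, ?_⟩
  rw [integral_integral_swap h]
  simp only [sandwich, freeResolvent]
  congr 1
  funext z
  rw [← mul_assoc, ← integral_const_mul]
  congr 1
  funext y
  ring

end Kernel

end Schrodinger

theorem lemma2 (V : Schrodinger.E3 → ℂ) (A ε : ℝ) (hA : 0 < A) (hε : 0 < ε)
    (hV : ContDiff ℝ 1 V)
    (hVdecay : ∀ x, ‖V x‖ ≤ A * Real.exp (-ε * ‖x‖))
    (hVgrad : ∀ x, ‖fderiv ℝ V x‖ ≤ ε * A * Real.exp (-ε * ‖x‖)) :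
    (∀ x, MeasureTheory.Integrable (fun y => ‖V y‖ / ‖x - y‖) MeasureTheory.volume) ∧
    IsGreatest (Set.range (Schrodinger.absPotential V)) (⨆ x, Schrodinger.absPotential V x) ∧
    ∀ k : ℂ, 0 < k.im →
      (∀ x y, MeasureTheory.Integrable (Schrodinger.integrandG V k x y) MeasureTheory.volume) ∧
      Schrodinger.IsIntegralKernel (Schrodinger.sandwich V k) (Schrodinger.G V k) ∧
      ∀ x y, ‖Schrodinger.G V k x y‖ ≤ Schrodinger.Ctilde V A / Schrodinger.h ε ‖k‖ := by
  exact ⟨Schrodinger.integrable_norm_div hA hε hV.continuous hVdecay,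
    Schrodinger.isGreatest_iSup_absPotential hA hε hV.continuous hVdecay, fun _ hk =>
    ⟨Schrodinger.integrable_integrandG hA hε hV.continuous hVdecay hk,
      Schrodinger.isIntegralKernel_G hA hε hV.continuous hVdecay hk,
      Schrodinger.norm_G_le_Ctilde_div hA hε hV hVdecay hVgrad hk⟩⟩
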